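/- Let $\alpha>1$, $\beta=\frac{\alpha}{\alpha-1}$ and $n_\beta=\max(\beta,2)$. Let $X$ be a real random variable and let $Z$ be standard normal, with $P$ and $Q$ the distributions of $X$ and $Z$. Put $$T_\alpha=T_\alpha(X\|Z)=\frac{1}{\alpha-1}\Big[\int\Big(\frac{dP}{dQ}\Big)^{\alpha}\,dQ-1\Big],$$ with $T_\alpha=\infty$ if $P$ is not absolutely continuous with respect to $Q$. (No assumption is made on the mean and variance of $X$.) Suppose that $T_\alpha<\infty$. Then $\mathbb E\,e^{-uX}<\infty$ for all $u\in\mathbb R$; put $$\psi(u)=\mathbb E\,e^{-uX}\,e^{-\beta u^2/2},\qquad u\in\mathbb R,$$ and $$A_\alpha=\big(1+(\alpha-1)T_\alpha\big)^{\frac1{\alpha-1}}\ \text{ if } 1<\alpha\le 2,\qquad A_\alpha=\big(1+(\alpha-1)T_\alpha\big)^{\frac2\alpha}\ \text{ if } \alpha>2 .$$ For independent copies $X_1,\dots,X_n$ of $X$ let $Z_n=(X_1+\dots+X_n)/\sqrt n$. (a) For every integer $n\ge n_\beta$, the normalized sum $Z_n$ has a (unique) continuous density $p_n$ with respect to Lebesgue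 measure, and for all $x\in\mathbb R$, $$p_n(x)\le \frac{A_\alpha\sqrt n}{(2\pi)^{1/2}}\,e^{-x^2/(2\beta)}\,\psi\Big(-\frac{x}{\beta\sqrt n}\Big)^{n-n_\beta}.$$ (b) There exist constants $x_0>0$ and $\delta\in(0,1)$, depending only on $\alpha$ and the distribution of $X$, such that for all sufficiently large $n$ (how large depending only on $\alpha$ and the distribution of $X$), $$p_n(x)\le \delta^n\,e^{-x^2/(2\beta)}\,\psi\Big(-\frac{x}{\beta\sqrt n}\Big)^{n/2}\qquad\text{whenever } |x|\ge x_0\sqrt n .$$ -/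

import Mathlib

open MeasureTheory ProbabilityTheory Filter
open scoped ENNReal

universe u v

/-- The relative Tsallis entropy (Rényi divergence power) of index `α > 1` of `P` from `Q`,
`T_α(P‖Q) = (α - 1)⁻¹ (∫ (dP/dQ)^α dQ - 1)`, as an extended real number. It is `+∞` when `P`
is not absolutely continuous with respect to `Q`, or when the integral diverges. -/
noncomputable def tsallis {S : Type*} [MeasurableSpace S] (α : ℝ) (P Q : Measure S) : EReal :=
  open scoped Classical in
  if P ≪ Q then
    (((α - 1)⁻¹ : ℝ) : EReal) * (((∫⁻ x, (P.rnDeriv Q x) ^ α ∂Q : ℝ≥0∞) : EReal) - 1)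
  else ⊤

/-- The conjugate index `β = α / (α - 1)`. -/
noncomputable def conjIndex (α : ℝ) : ℝ := α / (α - 1)

/-- `ψ(u) = E[e^{-uX}] e^{-βu²/2}`, where `β` is the conjugate index of `α`. -/
noncomputable def psi {Ω : Type*} [MeasurableSpace Ω] (α : ℝ) (P : Measure Ω) (X : Ω → ℝ)
    (u : ℝ) : ℝ :=
  (∫ ω, Real.exp (-(u * X ω)) ∂P) * Real.exp (-(conjIndex α * u ^ 2 / 2))

/-- The constant `A_α` attached to the value `T` of the Tsallis entropy:
`(1 + (α - 1) T)^{1/(α - 1)}` if `α ≤ 2`, and `(1 + (α - 1) T)^{2/α}` if `α > 2`. -/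
noncomputable def constA (α T : ℝ) : ℝ :=
  if α ≤ 2 then (1 + (α - 1) * T) ^ (1 / (α - 1)) else (1 + (α - 1) * T) ^ (2 / α)

/-- `ξ 0, …, ξ (n - 1)` are independent copies of `X`. -/
def IsIndepCopies {Ω Ω' : Type*} [MeasurableSpace Ω] [MeasurableSpace Ω'] {n : ℕ}
    (ξ : Fin n → Ω' → ℝ) (P' : Measure Ω') (X : Ω → ℝ) (P : Measure Ω) : Prop :=
  iIndepFun ξ P' ∧ ∀ i, IdentDistrib (ξ i) X P' P

/-- The normalized sum `Z_n = (ξ 0 + … + ξ (n - 1)) / √n`. -/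
noncomputable def normalizedSum {Ω' : Type*} {n : ℕ} (ξ : Fin n → Ω' → ℝ) (ω : Ω') : ℝ :=
  (∑ i, ξ i ω) / Real.sqrt n

/-- `p` is a continuous density, with respect to Lebesgue measure, of the measure `ν` on the
line. A measure has at most one continuous density. -/
def IsContinuousDensity (p : ℝ → ℝ) (ν : Measure ℝ) : Prop :=
  Continuous p ∧ (∀ x, 0 ≤ p x) ∧ ν = volume.withDensity (fun x => ENNReal.ofReal (p x))

/-! Let `φ` be the standard normal density, `f = dP/dQ`, `g = φ f` the density of `X`, and `I = ∫
f^α dQ = 1 + (α - 1) T_α`. The bound combines an exponential tilt with Young's inequality (constant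
1 suffices). Tilting commutes with convolution: the `n`-fold convolution of `g_h = e^{hx} g` is
`e^{hx} g^{*n}` (`iterConv_exp_mul`). Young bounds its supremum by `(∫ g_h^{n/(n-1)})^{n-1}`
(`iterConv_le_lintegral_rpow`), and log-convexity between `L^1` and `L^a`, `a = min α 2`, turns this
into `(∫ g_h)^{n - n_β} (∫ g_h^a)^{1/(a-1)}`, because `a/(a-1) = n_β`. The first integral is `ψ(-h)
e^{βh²/2}`; Hölder against two Gaussian densities bounds the second through `I`
(`lintegral_tilt_rpow_le`). Taking `h = x/(β√n)` at the point `√n x` gives (a). For (b), `ψ(u) → 0`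
as `|u| → ∞` (`exists_psi_le_of_le_abs`). So for `|x| ≥ x₀√n` half of the power of `ψ` is
exponentially small and absorbs the constant, the factor `√n` and the missing `n_β` powers. -/

/-! ### Young's convolution inequality on the line. -/

/-- Pointwise form of Young's convolution inequality. -/
theorem lconvolution_le_rpow_mul {f g : ℝ → ℝ≥0∞} (hf : Measurable f) (hg : Measurable g)
    {p q r : ℝ} (hp : 0 < p) (hq : 0 < q) (hr : 0 < r) (hpr : r⁻¹ ≤ p⁻¹) (hqr : r⁻¹ ≤ q⁻¹)
    (hpqr : p⁻¹ + q⁻¹ = 1 + r⁻¹) (x : ℝ) :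
    (f ⋆ₗ[volume] g) x ≤ (((fun y ↦ f y ^ p) ⋆ₗ[volume] (fun y ↦ g y ^ q)) x) ^ r⁻¹
      * (∫⁻ y, f y ^ p) ^ (p⁻¹ - r⁻¹) * (∫⁻ y, g y ^ q) ^ (q⁻¹ - r⁻¹) := by
  have hr' : 0 ≤ r⁻¹ := by positivity
  have key : ∀ (a : ℝ≥0∞) (s : ℝ), 0 < s → r⁻¹ ≤ s⁻¹ →
      a = (a ^ s) ^ r⁻¹ * (a ^ s) ^ (s⁻¹ - r⁻¹) := by
    intro a s hs hsr
    rw [← ENNReal.rpow_add_of_nonneg _ _ hr' (by linarith), add_sub_cancel,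
      ENNReal.rpow_rpow_inv hs.ne']
  have hgx : ∫⁻ y, g (-y + x) ^ q = ∫⁻ y, g y ^ q := by
    simp_rw [neg_add_eq_sub]
    exact lintegral_sub_left_eq_self (fun y ↦ g y ^ q) x
  -- Hölder for three functions; the weights `1/r`, `1/p - 1/r`, `1/q - 1/r` sum to 1 by `hpqr`.
  have hold := ENNReal.lintegral_prod_norm_pow_le (μ := (volume : Measure ℝ)) Finset.univ
    (f := ![fun y ↦ f y ^ p * g (-y + x) ^ q, fun y ↦ f y ^ p, fun y ↦ g (-y + x) ^ q])
    (p := ![r⁻¹, p⁻¹ - r⁻¹, q⁻¹ - r⁻¹])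
    (by
      intro i _
      fin_cases i
      · exact (show Measurable fun y ↦ f y ^ p * g (-y + x) ^ q by fun_prop).aemeasurable
      · exact (show Measurable fun y ↦ f y ^ p by fun_prop).aemeasurable
      · exact (show Measurable fun y ↦ g (-y + x) ^ q by fun_prop).aemeasurable)
    (by simp [Fin.sum_univ_three]; linarith)
    (by
      intro i _
      fin_cases i
      · exact hr'
      · exact sub_nonneg.2 hpr
      · exact sub_nonneg.2 hqr)
  simp only [Fin.prod_univ_three, Matrix.cons_val_zero, Matrix.cons_val_one,
    Matrix.cons_val] at hold
  rw [hgx] at hold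
  refine le_trans (le_of_eq ?_) hold
  refine lintegral_congr fun y ↦ ?_
  rw [ENNReal.mul_rpow_of_nonneg _ _ hr']
  conv_lhs => rw [key (f y) p hp hpr, key (g (-y + x)) q hq hqr]
  ring

theorem lintegral_lconvolution {f g : ℝ → ℝ≥0∞} (hf : Measurable f) (hg : Measurable g) :
    ∫⁻ x, (f ⋆ₗ[volume] g) x = (∫⁻ x, f x) * ∫⁻ x, g x := by
  simp_rw [lconvolution_def]
  rw [lintegral_lintegral_swap (by fun_prop)]
  have : ∀ y, ∫⁻ x, f y * g (-y + x) = f y * ∫⁻ x, g x := fun y ↦ by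
    rw [lintegral_const_mul _ (by fun_prop), lintegral_add_left_eq_self g (-y)]
  simp_rw [this]
  rw [lintegral_mul_const _ hf]

/-- **Young's convolution inequality** on the line, for finite exponents. -/
theorem lintegral_lconvolution_rpow_le {f g : ℝ → ℝ≥0∞} (hf : Measurable f) (hg : Measurable g)
    {p q r : ℝ} (hp : 0 < p) (hq : 0 < q) (hr : 0 < r) (hpr : r⁻¹ ≤ p⁻¹) (hqr : r⁻¹ ≤ q⁻¹)
    (hpqr : p⁻¹ + q⁻¹ = 1 + r⁻¹) :
    ∫⁻ x, ((f ⋆ₗ[volume] g) x) ^ r ≤ (∫⁻ y, f y ^ p) ^ (r / p) * (∫⁻ y, g y ^ q) ^ (r / q) := by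
  set F := ∫⁻ y, f y ^ p
  set G := ∫⁻ y, g y ^ q
  have hfp : Measurable fun y ↦ f y ^ p := by fun_prop
  have hgq : Measurable fun y ↦ g y ^ q := by fun_prop
  have hexp : ∀ (a : ℝ≥0∞) (s : ℝ), 0 < s → r⁻¹ ≤ s⁻¹ →
      a * a ^ ((s⁻¹ - r⁻¹) * r) = a ^ (r / s) := by
    intro a s hs hsr
    have h0 : 0 ≤ (s⁻¹ - r⁻¹) * r := mul_nonneg (sub_nonneg.2 hsr) hr.le
    nth_rewrite 1 [← ENNReal.rpow_one a]
    rw [← ENNReal.rpow_add_of_nonneg _ _ zero_le_one h0]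
    congr 1
    field_simp
    ring
  calc ∫⁻ x, ((f ⋆ₗ[volume] g) x) ^ r
      ≤ ∫⁻ x, ((fun y ↦ f y ^ p) ⋆ₗ[volume] (fun y ↦ g y ^ q)) x
          * (F ^ ((p⁻¹ - r⁻¹) * r) * G ^ ((q⁻¹ - r⁻¹) * r)) := by
        refine lintegral_mono fun x ↦ ?_
        refine (ENNReal.rpow_le_rpow
          (lconvolution_le_rpow_mul hf hg hp hq hr hpr hqr hpqr x) hr.le).trans (le_of_eq ?_)
        rw [ENNReal.mul_rpow_of_nonneg _ _ hr.le, ENNReal.mul_rpow_of_nonneg _ _ hr.le,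
          ENNReal.rpow_inv_rpow hr.ne', ← ENNReal.rpow_mul, ← ENNReal.rpow_mul, mul_assoc]
    _ = (F * F ^ ((p⁻¹ - r⁻¹) * r)) * (G * G ^ ((q⁻¹ - r⁻¹) * r)) := by
        rw [lintegral_mul_const _ (measurable_lconvolution _ hfp hgq),
          lintegral_lconvolution hfp hgq]
        ring
    _ = _ := by rw [hexp F p hp hpr, hexp G q hq hqr]

/-- **Young's convolution inequality** on the line, for the supremum norm. -/
theorem lconvolution_le_of_holderConjugate {f g : ℝ → ℝ≥0∞} (hf : Measurable f)
    (hg : Measurable g) {p q : ℝ} (hpq : p.HolderConjugate q) (x : ℝ) :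
    (f ⋆ₗ[volume] g) x ≤ (∫⁻ y, f y ^ p) ^ (1 / p) * (∫⁻ y, g y ^ q) ^ (1 / q) := by
  have hgx : ∫⁻ y, g (-y + x) ^ q = ∫⁻ y, g y ^ q := by
    simp_rw [neg_add_eq_sub]
    exact lintegral_sub_left_eq_self (fun y ↦ g y ^ q) x
  rw [← hgx]
  exact ENNReal.lintegral_mul_le_Lp_mul_Lq volume hpq hf.aemeasurable
    (show Measurable fun y ↦ g (-y + x) by fun_prop).aemeasurable

/-! ### Supremum of convolution powers. -/

/-- `iterConv g k` is the convolution of `k + 1` copies of `g`. -/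
noncomputable def iterConv (g : ℝ → ℝ≥0∞) : ℕ → ℝ → ℝ≥0∞
  | 0 => g
  | k + 1 => g ⋆ₗ[volume] iterConv g k

theorem measurable_iterConv {g : ℝ → ℝ≥0∞} (hg : Measurable g) (k : ℕ) :
    Measurable (iterConv g k) := by
  induction k with
  | zero => exact hg
  | succ k ih => exact measurable_lconvolution _ hg ih

/-- The norms of the iterated convolutions along the exponents `1 / r_k = 1 - (k + 1) / n`. -/
theorem lintegral_iterConv_rpow_le {g : ℝ → ℝ≥0∞} (hg : Measurable g) {n : ℝ} (hn : 1 < n)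
    (k : ℕ) (hk : (k : ℝ) + 1 < n) :
    ∫⁻ x, iterConv g k x ^ (n / (n - (k + 1)))
      ≤ (∫⁻ x, g x ^ (n / (n - 1))) ^ ((k + 1) * (n - 1) / (n - (k + 1))) := by
  induction k with
  | zero =>
    have : (n - 1) / (n - 1) = 1 := div_self (by linarith)
    simp [iterConv, this]
  | succ k ih =>
    push_cast at hk ⊢
    have h1 : 0 < n - 1 := by linarith
    have h2 : 0 < n - (k + 1) := by linarith
    have h3 : 0 < n - (k + 1 + 1) := by linarith
    have h0 : 0 < n := by linarith
    have hk0 : (0 : ℝ) ≤ k := k.cast_nonneg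
    -- The reciprocal exponents are `1 - 1/n`, `1 - (k+1)/n` and `1 - (k+2)/n`: each further factor
    -- costs `1/n`.
    have hY := lintegral_lconvolution_rpow_le hg (measurable_iterConv hg k)
      (p := n / (n - 1)) (q := n / (n - (k + 1))) (r := n / (n - (k + 1 + 1)))
      (by positivity) (by positivity) (by positivity)
      (by rw [inv_div, inv_div]; gcongr; linarith)
      (by rw [inv_div, inv_div]; gcongr; linarith)
      (by rw [inv_div, inv_div, inv_div]; field_simp; ring)
    refine hY.trans ?_
    have hpos : 0 ≤ n / (n - (k + 1 + 1)) / (n / (n - (k + 1))) := by positivity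
    refine (mul_le_mul_right (ENNReal.rpow_le_rpow (ih (by linarith)) hpos) _).trans (le_of_eq ?_)
    rw [← ENNReal.rpow_mul, ← ENNReal.rpow_add_of_nonneg _ _ (by positivity) (by positivity)]
    congr 1
    field_simp
    ring

/-- With `n = m + 2` factors, the first `n - 1` reach `L^n`, whose conjugate exponent `n/(n-1)` is
the one held by the last factor; Hölder then bounds the supremum. -/
theorem iterConv_le_lintegral_rpow {g : ℝ → ℝ≥0∞} (hg : Measurable g) (m : ℕ) (x : ℝ) :
    iterConv g (m + 1) x
      ≤ (∫⁻ y, g y ^ (((m : ℝ) + 2) / (m + 1))) ^ ((m : ℝ) + 1) := by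
  have hm : (0 : ℝ) ≤ m := m.cast_nonneg
  have hpq : (((m : ℝ) + 2) / (m + 1)).HolderConjugate ((m : ℝ) + 2) := by
    rw [Real.holderConjugate_iff]
    constructor
    · rw [lt_div_iff₀ (by positivity)]; linarith
    · rw [inv_div]; field_simp; ring
  refine (lconvolution_le_of_holderConjugate hg (measurable_iterConv hg m) hpq x).trans ?_
  have h := lintegral_iterConv_rpow_le hg (n := (m : ℝ) + 2) (by linarith) m (by linarith)
  have e1 : (m : ℝ) + 2 - (m + 1) = 1 := by ring
  have e2 : (m : ℝ) + 2 - 1 = m + 1 := by ring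
  rw [e1, e2, div_one, div_one] at h
  refine (mul_le_mul_right (ENNReal.rpow_le_rpow h (by positivity)) _).trans (le_of_eq ?_)
  rw [← ENNReal.rpow_mul, ← ENNReal.rpow_add_of_nonneg _ _ (by positivity) (by positivity)]
  congr 1
  field_simp
  ring

/-- Log-convexity of `p ↦ ∫ g ^ p` between `1` and `a`, with the exponents arranged for the
`(m + 2)`-fold convolution. -/
theorem lintegral_rpow_le_interpolation {g : ℝ → ℝ≥0∞} (hg : Measurable g) {a : ℝ} (ha : 1 < a)
    (m : ℕ) (hm : a / (a - 1) ≤ (m : ℝ) + 2) :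
    (∫⁻ y, g y ^ (((m : ℝ) + 2) / (m + 1))) ^ ((m : ℝ) + 1)
      ≤ (∫⁻ y, g y) ^ ((m : ℝ) + 2 - a / (a - 1)) * (∫⁻ y, g y ^ a) ^ (1 / (a - 1)) := by
  have ha1 : 0 < a - 1 := by linarith
  have hm1 : (0 : ℝ) < m + 1 := by positivity
  -- `t` solves `(1 - t) + t a = (m+2)/(m+1)`; the condition `t ≤ 1` is exactly `a/(a-1) ≤ m + 2`.
  set t : ℝ := 1 / ((m + 1) * (a - 1)) with ht
  have ht0 : 0 ≤ t := by positivity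
  have ht1 : t ≤ 1 := by
    rw [ht, div_le_one (by positivity)]
    rw [div_le_iff₀ ha1] at hm
    linarith
  have hle := ENNReal.lintegral_mul_norm_pow_le (μ := (volume : Measure ℝ)) hg.aemeasurable
    (hg.pow_const a).aemeasurable (sub_nonneg.2 ht1) ht0 (sub_add_cancel 1 t)
  have hexp : ∀ y, g y ^ (1 - t) * (g y ^ a) ^ t = g y ^ (((m : ℝ) + 2) / (m + 1)) := by
    intro y
    rw [← ENNReal.rpow_mul, ← ENNReal.rpow_add_of_nonneg _ _ (sub_nonneg.2 ht1) (by positivity)]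
    congr 1
    rw [ht]
    field_simp
    ring
  simp_rw [hexp] at hle
  refine (ENNReal.rpow_le_rpow hle hm1.le).trans (le_of_eq ?_)
  rw [ENNReal.mul_rpow_of_nonneg _ _ hm1.le, ← ENNReal.rpow_mul, ← ENNReal.rpow_mul]
  congr 2
  · rw [ht]; field_simp; ring
  · rw [ht]; field_simp

/-! ### Continuity of convolution powers. -/

/-- The convolution of functions in conjugate Lebesgue spaces is continuous. -/
theorem continuous_integral_mul_of_memLp {f g : ℝ → ℝ} {p q : ℝ≥0∞} [p.HolderConjugate q]
    (hp : p ≠ ∞) (hq : 1 ≤ q) (hf : MemLp f p volume) (hg : MemLp g q volume) :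
    Continuous fun x ↦ ∫ y, f y * g (-y + x) := by
  have hgx : ∀ x, MemLp (fun y ↦ g (-y + x)) q volume := fun x ↦ by
    simp_rw [neg_add_eq_sub]
    exact hg.comp_measurePreserving (Measure.measurePreserving_sub_left volume x)
  have hgn : ∀ x, eLpNorm (fun y ↦ g (-y + x)) q volume = eLpNorm g q volume := fun x ↦ by
    simp_rw [neg_add_eq_sub]
    exact eLpNorm_comp_measurePreserving hg.1 (Measure.measurePreserving_sub_left volume x)
  set C := (eLpNorm g q volume).toReal with hC
  have hC0 : 0 ≤ C := ENNReal.toReal_nonneg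
  have hint : ∀ {φ : ℝ → ℝ}, MemLp φ p volume → ∀ x, Integrable (fun y ↦ φ y * g (-y + x)) :=
    fun hφ x ↦ hφ.integrable_mul (hgx x)
  refine continuous_of_uniform_approx_of_continuous fun u hu ↦ ?_
  obtain ⟨ε, hε, hεu⟩ := Metric.mem_uniformity_dist.1 hu
  -- Replacing `f` by `φ` costs at most `C ε / (2(C+1)) < ε`, uniformly in `x`; the `+ 1` covers `C
  -- = 0`.
  have hδ : 0 < ε / (2 * (C + 1)) := by positivity
  obtain ⟨φ, hφc, hφn, hφ, hφp⟩ := hf.exists_hasCompactSupport_eLpNorm_sub_le hp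
    (ENNReal.ofReal_pos.2 hδ).ne'
  refine ⟨fun x ↦ ∫ y, φ y * g (-y + x), ?_, fun x ↦ hεu ?_⟩
  · have := hφc.continuous_convolution_left (ContinuousLinearMap.mul ℝ ℝ) (μ := volume) hφ
      (hg.locallyIntegrable hq)
    convert this using 2 with x
    simp [convolution, neg_add_eq_sub]
  · rw [Real.dist_eq, ← integral_sub (hint hf x) (hint hφp x)]
    have h1 : |∫ y, (f y * g (-y + x) - φ y * g (-y + x))|
        ≤ (∫⁻ y, ‖(f y - φ y) * g (-y + x)‖ₑ).toReal := by
      have := norm_integral_le_lintegral_norm (μ := volume)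
        (fun y ↦ f y * g (-y + x) - φ y * g (-y + x))
      simpa only [Real.norm_eq_abs, ← sub_mul, ofReal_norm, ← Real.enorm_eq_ofReal_abs] using this
    have h2 : ∫⁻ y, ‖(f y - φ y) * g (-y + x)‖ₑ
        ≤ ENNReal.ofReal (ε / (2 * (C + 1))) * ENNReal.ofReal C := by
      have := eLpNorm_smul_le_mul_eLpNorm (r := 1) (p := p) (q := q) (hgx x).1 (hf.sub hφp).1
      rw [eLpNorm_one_eq_lintegral_enorm, hgn] at this
      refine this.trans ?_
      rw [hC, ENNReal.ofReal_toReal hg.2.ne]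
      gcongr
    rw [← ENNReal.ofReal_mul hδ.le] at h2
    have h3 := ENNReal.toReal_le_of_le_ofReal (by positivity) h2
    refine (h1.trans h3).trans_lt ?_
    rw [div_mul_eq_mul_div, div_lt_iff₀ (by positivity)]
    nlinarith

theorem memLp_toReal_of_lintegral_rpow_lt_top {f : ℝ → ℝ≥0∞} (hf : Measurable f) {p : ℝ}
    (hp : 0 < p) (h : ∫⁻ x, f x ^ p < ∞) :
    MemLp (fun x ↦ (f x).toReal) (ENNReal.ofReal p) volume := by
  refine ⟨hf.ennreal_toReal.aestronglyMeasurable, ?_⟩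
  rw [eLpNorm_lt_top_iff_lintegral_rpow_enorm_lt_top (ENNReal.ofReal_pos.2 hp).ne'
    ENNReal.ofReal_ne_top, ENNReal.toReal_ofReal hp.le]
  refine lt_of_le_of_lt (lintegral_mono fun x ↦ ?_) h
  gcongr
  rw [Real.enorm_eq_ofReal ENNReal.toReal_nonneg]
  exact ENNReal.ofReal_toReal_le

theorem continuous_toReal_lconvolution {f g : ℝ → ℝ≥0∞} (hf : Measurable f) (hg : Measurable g)
    {p q : ℝ} (hpq : p.HolderConjugate q) (hfp : ∫⁻ x, f x ^ p < ∞) (hgq : ∫⁻ x, g x ^ q < ∞) :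
    Continuous fun x ↦ ((f ⋆ₗ[volume] g) x).toReal := by
  have : (ENNReal.ofReal p).HolderConjugate (ENNReal.ofReal q) := hpq.ennrealOfReal
  have hc := continuous_integral_mul_of_memLp (p := ENNReal.ofReal p) (q := ENNReal.ofReal q)
    ENNReal.ofReal_ne_top (by simpa using hpq.symm.lt.le)
    (memLp_toReal_of_lintegral_rpow_lt_top hf hpq.pos hfp)
    (memLp_toReal_of_lintegral_rpow_lt_top hg hpq.symm.pos hgq)
  convert hc using 2 with x
  -- Finiteness at every `x`, not just almost every one, identifies `toReal` of the convolution with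
  -- the Bochner integral pointwise.
  have hlt : (f ⋆ₗ[volume] g) x < ∞ := by
    refine (lconvolution_le_of_holderConjugate hf hg hpq x).trans_lt ?_
    exact ENNReal.mul_lt_top (ENNReal.rpow_lt_top_of_nonneg (by have := hpq.pos; positivity) hfp.ne)
      (ENNReal.rpow_lt_top_of_nonneg (by have := hpq.symm.pos; positivity) hgq.ne)
  have hm : Measurable fun y ↦ f y * g (-y + x) := by fun_prop
  rw [lconvolution_def] at hlt ⊢
  rw [← integral_toReal hm.aemeasurable (ae_lt_top hm hlt.ne)]
  simp [ENNReal.toReal_mul]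

theorem continuous_toReal_iterConv {g : ℝ → ℝ≥0∞} (hg : Measurable g) (m : ℕ)
    (h : ∫⁻ y, g y ^ (((m : ℝ) + 2) / (m + 1)) < ∞) :
    Continuous fun x ↦ (iterConv g (m + 1) x).toReal := by
  have hm : (0 : ℝ) ≤ m := m.cast_nonneg
  have hpq : (((m : ℝ) + 2) / (m + 1)).HolderConjugate ((m : ℝ) + 2) := by
    rw [Real.holderConjugate_iff]
    constructor
    · rw [lt_div_iff₀ (by positivity)]; linarith
    · rw [inv_div]; field_simp; ring
  have h' := lintegral_iterConv_rpow_le hg (n := (m : ℝ) + 2) (by linarith) m (by linarith)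
  have e1 : (m : ℝ) + 2 - (m + 1) = 1 := by ring
  have e2 : (m : ℝ) + 2 - 1 = m + 1 := by ring
  rw [e1, e2, div_one, div_one] at h'
  exact continuous_toReal_lconvolution hg (measurable_iterConv hg m) hpq h
    (h'.trans_lt (ENNReal.rpow_lt_top_of_nonneg (by positivity) h.ne))

/-! ### Exponential tilting and Gaussian estimates. -/

/-- Exponential tilting commutes with convolution powers. -/
theorem iterConv_exp_mul {g : ℝ → ℝ≥0∞} (hg : Measurable g) (h : ℝ) (k : ℕ) (x : ℝ) :
    iterConv (fun y ↦ ENNReal.ofReal (Real.exp (h * y)) * g y) k x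
      = ENNReal.ofReal (Real.exp (h * x)) * iterConv g k x := by
  induction k generalizing x with
  | zero => rfl
  | succ k ih =>
    have hgk := measurable_iterConv hg k
    simp only [iterConv, lconvolution_def, ih]
    rw [← lintegral_const_mul _ (by fun_prop)]
    refine lintegral_congr fun y ↦ ?_
    have : Real.exp (h * x) = Real.exp (h * y) * Real.exp (h * (-y + x)) := by
      rw [← Real.exp_add]; ring_nf
    rw [this, ENNReal.ofReal_mul (Real.exp_pos _).le]
    ring

theorem gaussianPDF_zero_one_rpow (m x s : ℝ) :
    gaussianPDF m 1 x ^ s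
      = ENNReal.ofReal ((Real.sqrt (2 * Real.pi))⁻¹ ^ s * Real.exp (-(s * (x - m) ^ 2 / 2))) := by
  have hpi : 0 < (Real.sqrt (2 * Real.pi))⁻¹ := by positivity
  rw [gaussianPDF, ENNReal.ofReal_rpow_of_pos (gaussianPDFReal_pos _ _ _ one_ne_zero),
    gaussianPDFReal]
  congr 1
  simp only [NNReal.coe_one, mul_one]
  rw [Real.mul_rpow hpi.le (Real.exp_pos _).le, ← Real.exp_mul]
  ring_nf

/-- Completing the square: the two exponents differ by `(a - 1)(x - βh)²/2 ≥ 0`. The right side is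
shaped for Hölder with weights `a/α` and `1 - a/α`, where the shifted Gaussian integrates to 1. -/
theorem exp_mul_gaussianPDF_rpow_le {α a : ℝ} (hα : 1 < α) (ha : 1 ≤ a) (h x : ℝ) :
    (ENNReal.ofReal (Real.exp (h * x)) * gaussianPDF 0 1 x) ^ a
      ≤ ENNReal.ofReal ((Real.sqrt (2 * Real.pi))⁻¹ ^ (a - 1)
          * Real.exp (a * conjIndex α * h ^ 2 / 2))
        * (gaussianPDF 0 1 x ^ (a / α) * gaussianPDF (conjIndex α * h) 1 x ^ (1 - a / α)) := by
  have hα0 : α ≠ 0 := by positivity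
  have hα1 : α - 1 ≠ 0 := by linarith
  set c := (Real.sqrt (2 * Real.pi))⁻¹ with hc
  have hc0 : 0 < c := by positivity
  rw [ENNReal.mul_rpow_of_nonneg _ _ (by linarith), gaussianPDF_zero_one_rpow,
    gaussianPDF_zero_one_rpow, gaussianPDF_zero_one_rpow,
    ENNReal.ofReal_rpow_of_pos (Real.exp_pos _), ← Real.exp_mul,
    ← ENNReal.ofReal_mul (by positivity), ← ENNReal.ofReal_mul (by positivity),
    ← ENNReal.ofReal_mul (by positivity)]
  apply ENNReal.ofReal_le_ofReal
  rw [← hc]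
  have hcc : c ^ a = c ^ (a - 1) * (c ^ (a / α) * c ^ (1 - a / α)) := by
    rw [← Real.rpow_add hc0, ← Real.rpow_add hc0]; congr 1; ring
  calc Real.exp (h * x * a) * (c ^ a * Real.exp (-(a * (x - 0) ^ 2 / 2)))
      = c ^ a * Real.exp (h * x * a + -(a * (x - 0) ^ 2 / 2)) := by rw [Real.exp_add]; ring
    _ ≤ c ^ a * Real.exp (a * conjIndex α * h ^ 2 / 2
          + (-(a / α * (x - 0) ^ 2 / 2) + -((1 - a / α) * (x - conjIndex α * h) ^ 2 / 2))) := by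
        refine mul_le_mul_of_nonneg_left (Real.exp_le_exp.2 ?_) (by positivity)
        have key : a * conjIndex α * h ^ 2 / 2
            + (-(a / α * (x - 0) ^ 2 / 2) + -((1 - a / α) * (x - conjIndex α * h) ^ 2 / 2))
            - (h * x * a + -(a * (x - 0) ^ 2 / 2))
            = (a - 1) * (x - conjIndex α * h) ^ 2 / 2 := by
          unfold conjIndex; field_simp; ring
        have : 0 ≤ (a - 1) * (x - conjIndex α * h) ^ 2 / 2 :=
          div_nonneg (mul_nonneg (by linarith) (sq_nonneg _)) zero_le_two
        linarith
    _ = _ := by rw [hcc, Real.exp_add, Real.exp_add]; ring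

/-- The `L^a` norms of the tilted densities `e^{hx} f φ`, `1 ≤ a ≤ α`, are controlled by the
`L^α` norm of `f` under the standard Gaussian measure. -/
theorem lintegral_tilt_rpow_le {α a : ℝ} (hα : 1 < α) (ha : 1 ≤ a) (haα : a ≤ α)
    {f : ℝ → ℝ≥0∞} (hf : Measurable f) (h : ℝ) :
    ∫⁻ x, (ENNReal.ofReal (Real.exp (h * x)) * (gaussianPDF 0 1 x * f x)) ^ a
      ≤ ENNReal.ofReal ((Real.sqrt (2 * Real.pi))⁻¹ ^ (a - 1)
          * Real.exp (a * conjIndex α * h ^ 2 / 2))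
        * (∫⁻ x, f x ^ α ∂gaussianReal 0 1) ^ (a / α) := by
  have hα0 : α ≠ 0 := by positivity
  have h0 : 0 ≤ a / α := by positivity
  have h1 : 0 ≤ 1 - a / α := sub_nonneg.2 ((div_le_one (by positivity)).2 haα)
  have hφ := measurable_gaussianPDF 0 1
  have hφ' := measurable_gaussianPDF (conjIndex α * h) 1
  have hQ : ∫⁻ x, f x ^ α ∂gaussianReal 0 1 = ∫⁻ x, gaussianPDF 0 1 x * f x ^ α := by
    rw [gaussianReal_of_var_ne_zero _ one_ne_zero,
      lintegral_withDensity_eq_lintegral_mul _ hφ (by fun_prop)]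
    rfl
  have hH := ENNReal.lintegral_mul_norm_pow_le (μ := (volume : Measure ℝ))
    (f := fun x ↦ gaussianPDF 0 1 x * f x ^ α) (g := gaussianPDF (conjIndex α * h) 1)
    (by fun_prop) hφ'.aemeasurable h0 h1 (by ring)
  rw [lintegral_gaussianPDF_eq_one _ one_ne_zero, ENNReal.one_rpow, mul_one, ← hQ] at hH
  refine le_trans ?_ (mul_le_mul_right hH _)
  rw [← lintegral_const_mul _ (by fun_prop)]
  refine lintegral_mono fun x ↦ ?_
  have e1 : f x ^ a = (f x ^ α) ^ (a / α) := by
    rw [← ENNReal.rpow_mul]; congr 1; field_simp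
  rw [← mul_assoc, ENNReal.mul_rpow_of_nonneg _ _ (by linarith : 0 ≤ a),
    ENNReal.mul_rpow_of_nonneg _ _ h0, e1]
  refine (mul_le_mul_left (exp_mul_gaussianPDF_rpow_le hα ha h x) _).trans (le_of_eq ?_)
  ring

/-! ### Laws of sums, and what finite Tsallis entropy gives. -/

theorem map_sum_eq_withDensity_iterConv {Ω' ι : Type*} [MeasurableSpace Ω'] {P' : Measure Ω'}
    [IsProbabilityMeasure P'] {ξ : ι → Ω' → ℝ} (hξ : iIndepFun ξ P')
    (hm : ∀ i, AEMeasurable (ξ i) P') {g : ℝ → ℝ≥0∞} (hg : Measurable g)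
    (hlaw : ∀ i, P'.map (ξ i) = volume.withDensity g) (k : ℕ) (s : Finset ι)
    (hs : s.card = k + 1) :
    P'.map (∑ i ∈ s, ξ i) = volume.withDensity (iterConv g k) := by
  classical
  induction k generalizing s with
  | zero =>
    obtain ⟨i, rfl⟩ := Finset.card_eq_one.1 hs
    simpa [iterConv] using hlaw i
  | succ k ih =>
    obtain ⟨i, t, hit, rfl, ht⟩ := Finset.card_eq_succ.1 hs
    have hind := (hξ.indepFun_finsetSum_of_notMem₀ hm hit).symm
    rw [Finset.sum_insert hit, hind.map_add_eq_map_conv_map₀ (hm i)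
      (Finset.aemeasurable_sum _ fun j _ ↦ hm j), hlaw, ih t ht,
      conv_withDensity_eq_lconvolution hg (measurable_iterConv hg k)]
    rfl

theorem map_div_withDensity {c : ℝ} (hc : 0 < c) {G : ℝ → ℝ≥0∞} (hG : Measurable G) :
    (volume.withDensity G).map (fun x ↦ x / c)
      = volume.withDensity fun x ↦ ENNReal.ofReal c * G (c * x) := by
  refine Measure.ext_of_lintegral _ fun φ hφ ↦ ?_
  rw [lintegral_map hφ (by fun_prop), lintegral_withDensity_eq_lintegral_mul _ hG (by fun_prop),
    lintegral_withDensity_eq_lintegral_mul _ (by fun_prop) hφ]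
  have hv : (volume : Measure ℝ) = ENNReal.ofReal c • volume.map (c * ·) := by
    have := Real.smul_map_volume_mul_left hc.ne'
    rw [abs_of_pos hc] at this
    exact this.symm
  conv_lhs => rw [hv]
  rw [lintegral_smul_measure, lintegral_map (by fun_prop) (by fun_prop), smul_eq_mul,
    ← lintegral_const_mul _ (by fun_prop)]
  refine lintegral_congr fun x ↦ ?_
  simp only [Pi.mul_apply, mul_div_cancel_left₀ x hc.ne']
  ring

theorem tsallis_lt_top_iff {S : Type*} [MeasurableSpace S] {α : ℝ} (hα : 1 < α)
    {μ Q : Measure S} :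
    tsallis α μ Q < ⊤ ↔ μ ≪ Q ∧ ∫⁻ x, μ.rnDeriv Q x ^ α ∂Q < ∞ := by
  have hpos : 0 < (α - 1)⁻¹ := inv_pos.2 (by linarith)
  unfold tsallis
  split_ifs with h
  · simp only [h, true_and]
    rcases eq_or_ne (∫⁻ x, μ.rnDeriv Q x ^ α ∂Q) ∞ with hI | hI
    · rw [hI]
      have : ((∞ : ℝ≥0∞) : EReal) - 1 = ⊤ := rfl
      rw [this, EReal.coe_mul_top_of_pos hpos]
      simp
    · rw [← EReal.coe_ennreal_toReal hI, ← EReal.coe_one, ← EReal.coe_sub, ← EReal.coe_mul]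
      exact iff_of_true (EReal.coe_lt_top _) hI.lt_top
  · simp [h]

theorem one_add_mul_toReal_tsallis {S : Type*} [MeasurableSpace S] {α : ℝ} (hα : 1 < α)
    {μ Q : Measure S} (h : tsallis α μ Q < ⊤) :
    1 + (α - 1) * (tsallis α μ Q).toReal = (∫⁻ x, μ.rnDeriv Q x ^ α ∂Q).toReal := by
  obtain ⟨hac, hI⟩ := (tsallis_lt_top_iff hα).1 h
  have h1 : α - 1 ≠ 0 := by linarith
  unfold tsallis
  rw [if_pos hac, ← EReal.coe_ennreal_toReal hI.ne, ← EReal.coe_one, ← EReal.coe_sub,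
    ← EReal.coe_mul, EReal.toReal_coe]
  field_simp
  ring

theorem eq_withDensity_gaussianPDF_mul {μ : Measure ℝ} [SigmaFinite μ]
    (h : μ ≪ gaussianReal 0 1) :
    μ = volume.withDensity
      fun x ↦ gaussianPDF 0 1 x * μ.rnDeriv (gaussianReal 0 1) x := by
  conv_lhs => rw [← Measure.withDensity_rnDeriv_eq _ _ h]
  set f := μ.rnDeriv (gaussianReal 0 1)
  have hf : Measurable f := Measure.measurable_rnDeriv _ _
  rw [gaussianReal_of_var_ne_zero _ one_ne_zero,
    ← withDensity_mul _ (measurable_gaussianPDF 0 1) hf]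
  rfl

theorem lintegral_exp_mul_eq {Ω : Type*} [MeasurableSpace Ω] {P : Measure Ω} {X : Ω → ℝ}
    (hX : AEMeasurable X P) {g : ℝ → ℝ≥0∞} (hg : Measurable g)
    (hlaw : P.map X = volume.withDensity g) (h : ℝ) :
    ∫⁻ ω, ENNReal.ofReal (Real.exp (h * X ω)) ∂P
      = ∫⁻ x, ENNReal.ofReal (Real.exp (h * x)) * g x := by
  rw [← lintegral_map' (f := fun x ↦ ENNReal.ofReal (Real.exp (h * x))) (by fun_prop) hX, hlaw,
    lintegral_withDensity_eq_lintegral_mul _ hg (by fun_prop)]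
  simp [mul_comm]

/-! ### Tilted bounds in terms of `ψ`. -/

section

variable {Ω : Type*} [MeasurableSpace Ω] {P : Measure Ω} {X : Ω → ℝ} {α : ℝ} {f : ℝ → ℝ≥0∞}

theorem integrable_exp_of_lintegral_rpow_lt_top (hX : AEMeasurable X P) (hα : 1 < α)
    (hf : Measurable f)
    (hlaw : P.map X = volume.withDensity fun x ↦ gaussianPDF 0 1 x * f x)
    (hI : ∫⁻ x, f x ^ α ∂gaussianReal 0 1 < ∞) (h : ℝ) :
    Integrable (fun ω ↦ Real.exp (h * X ω)) P := by
  refine ⟨by fun_prop, ?_⟩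
  have hφ := measurable_gaussianPDF 0 1
  rw [hasFiniteIntegral_iff_ofReal (ae_of_all _ fun ω ↦ (Real.exp_pos _).le),
    lintegral_exp_mul_eq hX (by fun_prop) hlaw]
  have := lintegral_tilt_rpow_le hα le_rfl hα.le hf h
  simp only [ENNReal.rpow_one] at this
  exact this.trans_lt (ENNReal.mul_lt_top ENNReal.ofReal_lt_top
    (ENNReal.rpow_lt_top_of_nonneg (by positivity) hI.ne))

theorem lintegral_tilt_eq_psi (hX : AEMeasurable X P) (hα : 1 < α) (hf : Measurable f)
    (hlaw : P.map X = volume.withDensity fun x ↦ gaussianPDF 0 1 x * f x)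
    (hI : ∫⁻ x, f x ^ α ∂gaussianReal 0 1 < ∞) (h : ℝ) :
    ∫⁻ x, ENNReal.ofReal (Real.exp (h * x)) * (gaussianPDF 0 1 x * f x)
      = ENNReal.ofReal (psi α P X (-h) * Real.exp (conjIndex α * h ^ 2 / 2)) := by
  have hφ := measurable_gaussianPDF 0 1
  rw [← lintegral_exp_mul_eq hX (by fun_prop) hlaw,
    ← ofReal_integral_eq_lintegral_ofReal
      (integrable_exp_of_lintegral_rpow_lt_top hX hα hf hlaw hI h)
      (ae_of_all _ fun ω ↦ (Real.exp_pos _).le)]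
  simp only [psi, neg_mul, neg_neg, neg_sq]
  rw [mul_assoc, ← Real.exp_add, neg_add_cancel, Real.exp_zero, mul_one]

theorem psi_pos [NeZero P] (hX : AEMeasurable X P) (hα : 1 < α) (hf : Measurable f)
    (hlaw : P.map X = volume.withDensity fun x ↦ gaussianPDF 0 1 x * f x)
    (hI : ∫⁻ x, f x ^ α ∂gaussianReal 0 1 < ∞) (u : ℝ) : 0 < psi α P X u := by
  have := integrable_exp_of_lintegral_rpow_lt_top hX hα hf hlaw hI (-u)
  simp only [neg_mul] at this
  exact mul_pos (integral_exp_pos this) (Real.exp_pos _)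

/-- Sup-norm bound for tilted convolution powers of a density `f φ` with `f ∈ L^α(φ)`. -/
theorem exp_mul_iterConv_le [NeZero P] (hX : AEMeasurable X P) (hα : 1 < α) (hf : Measurable f)
    (hlaw : P.map X = volume.withDensity fun x ↦ gaussianPDF 0 1 x * f x)
    (hI : ∫⁻ x, f x ^ α ∂gaussianReal 0 1 < ∞) {a : ℝ} (ha : 1 < a) (haα : a ≤ α)
    (m : ℕ) (hm : a / (a - 1) ≤ (m : ℝ) + 2) (h y : ℝ) :
    ENNReal.ofReal (Real.exp (h * y))
        * iterConv (fun x ↦ gaussianPDF 0 1 x * f x) (m + 1) y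
      ≤ ENNReal.ofReal ((psi α P X (-h)) ^ ((m : ℝ) + 2 - a / (a - 1))
        * (Real.sqrt (2 * Real.pi))⁻¹
        * Real.exp (((m : ℝ) + 2) * (conjIndex α * h ^ 2 / 2))
        * (∫⁻ x, f x ^ α ∂gaussianReal 0 1).toReal ^ (a / (α * (a - 1)))) := by
  have hφ := measurable_gaussianPDF 0 1
  have hg : Measurable fun x ↦ gaussianPDF 0 1 x * f x := by fun_prop
  have ha1 : 0 < a - 1 := by linarith
  have hψ := psi_pos hX hα hf hlaw hI (-h)
  have hn : 0 ≤ (m : ℝ) + 2 - a / (a - 1) := by linarith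
  set I := ∫⁻ x, f x ^ α ∂gaussianReal 0 1 with hIdef
  set c := (Real.sqrt (2 * Real.pi))⁻¹ with hc
  have hc0 : 0 < c := by positivity
  set B := conjIndex α * h ^ 2 / 2 with hB
  rw [← iterConv_exp_mul hg]
  have ht : Measurable fun y ↦ ENNReal.ofReal (Real.exp (h * y)) * (gaussianPDF 0 1 y * f y) := by
    fun_prop
  refine ((iterConv_le_lintegral_rpow ht m y).trans
    (lintegral_rpow_le_interpolation ht ha m hm)).trans ?_
  have h2 := ENNReal.rpow_le_rpow (lintegral_tilt_rpow_le hα ha.le haα hf h)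
    (by positivity : 0 ≤ 1 / (a - 1))
  rw [lintegral_tilt_eq_psi hX hα hf hlaw hI h]
  refine (mul_le_mul_right h2 _).trans (le_of_eq ?_)
  rw [← hIdef, ← hc, ENNReal.mul_rpow_of_nonneg _ _ (by positivity), ← ENNReal.rpow_mul,
    ENNReal.ofReal_rpow_of_pos (by positivity), ENNReal.ofReal_rpow_of_pos (by positivity)]
  have hIr : I ^ (a / α * (1 / (a - 1))) = ENNReal.ofReal (I.toReal ^ (a / (α * (a - 1)))) := by
    rw [ENNReal.toReal_rpow, ENNReal.ofReal_toReal
      (ENNReal.rpow_lt_top_of_nonneg (by positivity) hI.ne).ne]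
    congr 1
    field_simp
  rw [hIr, ← ENNReal.ofReal_mul (by positivity), ← ENNReal.ofReal_mul (by positivity)]
  congr 1
  rw [Real.mul_rpow hψ.le (by positivity), Real.mul_rpow (by positivity) (by positivity),
    ← Real.rpow_mul hc0.le, ← Real.exp_mul, ← Real.exp_mul, mul_one_div_cancel ha1.ne',
    Real.rpow_one]
  -- The factor `e^{βh²/2}` occurs `m + 2 - a/(a-1)` times from the `L^1` norm and `a/(a-1)` times
  -- from the `L^a` norm, so `m + 2` times in all.
  have hexp : Real.exp (((m : ℝ) + 2) * B)
      = Real.exp (B * ((m : ℝ) + 2 - a / (a - 1)))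
        * Real.exp (a * conjIndex α * h ^ 2 / 2 * (1 / (a - 1))) := by
    rw [← Real.exp_add, hB]
    congr 1
    field_simp
    ring
  rw [hexp]
  ring

end

/-! ### The density bound (a). -/

/-- For `a = min α 2` the interpolation condition `a/(a-1) ≤ n` becomes `n ≥ n_β`. -/
theorem min_div_min_sub_one_eq {α : ℝ} (hα : 1 < α) :
    min α 2 / (min α 2 - 1) = max (conjIndex α) 2 := by
  have h1 : 0 < α - 1 := by linarith
  unfold conjIndex
  rcases le_total α 2 with h | h
  · rw [min_eq_left h, max_eq_left]
    rw [le_div_iff₀ h1]; linarith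
  · rw [min_eq_right h, max_eq_right]
    · norm_num
    · rw [div_le_iff₀ h1]; linarith

/-- One exponent covers both cases of `A_α`: `a = α` gives `1/(α-1)` and `a = 2` gives `2/α`. -/
theorem constA_eq_rpow_min {α : ℝ} (hα : 1 < α) (T : ℝ) :
    constA α T = (1 + (α - 1) * T) ^ (min α 2 / (α * (min α 2 - 1))) := by
  have h1 : α - 1 ≠ 0 := by linarith
  have h0 : α ≠ 0 := by linarith
  unfold constA
  split_ifs with h
  · rw [min_eq_left h]
    congr 1
    field_simp
  · rw [min_eq_right (le_of_not_ge h)]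
    congr 1
    norm_num

theorem isContinuousDensity_normalizedSum {Ω' : Type*} [MeasurableSpace Ω'] {P' : Measure Ω'}
    [IsProbabilityMeasure P'] {m : ℕ} {ξ : Fin (m + 2) → Ω' → ℝ} (hξ : iIndepFun ξ P')
    (hm : ∀ i, AEMeasurable (ξ i) P') {g : ℝ → ℝ≥0∞} (hg : Measurable g)
    (hlaw : ∀ i, P'.map (ξ i) = volume.withDensity g)
    (hfin : ∫⁻ y, g y ^ (((m : ℝ) + 2) / (m + 1)) < ∞) :
    IsContinuousDensity
      (fun x ↦ Real.sqrt (m + 2 : ℕ) * (iterConv g (m + 1) (Real.sqrt (m + 2 : ℕ) * x)).toReal)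
      (P'.map (normalizedSum ξ)) := by
  have hs : 0 < Real.sqrt (m + 2 : ℕ) := Real.sqrt_pos.2 (by positivity)
  have hcont := continuous_toReal_iterConv hg m hfin
  refine ⟨continuous_const.mul (hcont.comp (continuous_const.mul continuous_id)),
    fun x ↦ by positivity, ?_⟩
  have hsum := map_sum_eq_withDensity_iterConv hξ hm hg hlaw (m + 1) Finset.univ (by simp)
  have hcomp : normalizedSum ξ = (fun x ↦ x / Real.sqrt (m + 2 : ℕ)) ∘ (∑ i, ξ i) := by
    ext ω
    simp [normalizedSum]
  rw [hcomp, ← AEMeasurable.map_map_of_aemeasurable (by fun_prop)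
    (Finset.aemeasurable_sum _ fun i _ ↦ hm i), hsum,
    map_div_withDensity hs (measurable_iterConv hg _)]
  congr 1 with x
  rw [ENNReal.ofReal_mul hs.le, ENNReal.ofReal_toReal]
  refine ((iterConv_le_lintegral_rpow hg m _).trans_lt ?_).ne
  exact ENNReal.rpow_lt_top_of_nonneg (by positivity) hfin.ne

section

variable {Ω : Type*} [MeasurableSpace Ω] {P : Measure Ω} {X : Ω → ℝ} {α : ℝ} {f : ℝ → ℝ≥0∞}

theorem exists_density_le [IsProbabilityMeasure P] (hX : AEMeasurable X P) (hα : 1 < α)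
    (hf : Measurable f)
    (hlaw : P.map X = volume.withDensity fun x ↦ gaussianPDF 0 1 x * f x)
    (hI : ∫⁻ x, f x ^ α ∂gaussianReal 0 1 < ∞) {n : ℕ} (hn : max (conjIndex α) 2 ≤ (n : ℝ))
    {Ω' : Type*} [MeasurableSpace Ω'] {P' : Measure Ω'} [IsProbabilityMeasure P']
    {ξ : Fin n → Ω' → ℝ} (hξ : IsIndepCopies ξ P' X P) :
    ∃ p : ℝ → ℝ, IsContinuousDensity p (P'.map (normalizedSum ξ)) ∧ ∀ x : ℝ, p x ≤
      (∫⁻ x, f x ^ α ∂gaussianReal 0 1).toReal ^ (min α 2 / (α * (min α 2 - 1))) * Real.sqrt n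
          / Real.sqrt (2 * Real.pi)
        * Real.exp (-(x ^ 2 / (2 * conjIndex α)))
        * psi α P X (-(x / (conjIndex α * Real.sqrt n))) ^ ((n : ℝ) - max (conjIndex α) 2) := by
  obtain ⟨m, rfl⟩ : ∃ m, n = m + 2 := by
    have : (2 : ℝ) ≤ n := (le_max_right _ _).trans hn
    exact Nat.exists_eq_add_of_le' (by exact_mod_cast this)
  have hnm : ((m + 2 : ℕ) : ℝ) = (m : ℝ) + 2 := by push_cast; ring
  have hφ := measurable_gaussianPDF 0 1
  have hg : Measurable fun x ↦ gaussianPDF 0 1 x * f x := by fun_prop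
  have hβ : 0 < conjIndex α := div_pos (by linarith) (by linarith)
  have ha : 1 < min α 2 := lt_min hα one_lt_two
  have hma : min α 2 / (min α 2 - 1) ≤ (m : ℝ) + 2 := by
    rw [min_div_min_sub_one_eq hα, ← hnm]; exact hn
  have hs : 0 < Real.sqrt (m + 2 : ℕ) := Real.sqrt_pos.2 (by positivity)
  have hr1 : 1 ≤ ((m : ℝ) + 2) / (m + 1) := by
    rw [le_div_iff₀ (by positivity)]; linarith
  have hrα : ((m : ℝ) + 2) / (m + 1) ≤ min α 2 := by
    rw [div_le_iff₀ (by linarith)] at hma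
    rw [div_le_iff₀ (by positivity)]
    linarith
  -- The tilt estimate at `h = 0`; the exponent `n/(n-1)` is at most `min α 2` because `n ≥ n_β`.
  have hfin : ∫⁻ y, (gaussianPDF 0 1 y * f y) ^ (((m : ℝ) + 2) / (m + 1)) < ∞ := by
    have := lintegral_tilt_rpow_le hα hr1 (hrα.trans (min_le_left _ _)) hf 0
    simp only [zero_mul, Real.exp_zero, ENNReal.ofReal_one, one_mul] at this
    exact this.trans_lt (ENNReal.mul_lt_top ENNReal.ofReal_lt_top
      (ENNReal.rpow_lt_top_of_nonneg (by positivity) hI.ne))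
  refine ⟨_, isContinuousDensity_normalizedSum hξ.1 (fun i ↦ (hξ.2 i).aemeasurable_fst) hg
    (fun i ↦ (hξ.2 i).map_eq.trans hlaw) hfin, fun x ↦ ?_⟩
  set s := Real.sqrt (m + 2 : ℕ) with hsdef
  have hss : s ^ 2 = (m : ℝ) + 2 := by rw [hsdef, Real.sq_sqrt (by positivity), hnm]
  -- This `h` minimizes `nβh²/2 - h√n x`, with minimum `-x²/(2β)`.
  set h := x / (conjIndex α * s) with hh
  have hψ := psi_pos hX hα hf hlaw hI (-h)
  have hb := exp_mul_iterConv_le hX hα hf hlaw hI ha (min_le_left _ _) m hma h (s * x)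
  have hb' := ENNReal.toReal_mono ENNReal.ofReal_ne_top hb
  rw [ENNReal.toReal_mul, ENNReal.toReal_ofReal (Real.exp_pos _).le,
    ENNReal.toReal_ofReal (by positivity)] at hb'
  have e1 : h * (s * x) = x ^ 2 / (2 * conjIndex α) + x ^ 2 / (2 * conjIndex α) := by
    rw [hh]; field_simp; ring
  have e2 : ((m : ℝ) + 2) * (conjIndex α * h ^ 2 / 2) = x ^ 2 / (2 * conjIndex α) := by
    rw [hh, ← hss]; field_simp
  rw [e1, e2, Real.exp_add, min_div_min_sub_one_eq hα] at hb'
  rw [hnm, Real.exp_neg]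
  set E := Real.exp (x ^ 2 / (2 * conjIndex α)) with hE
  have hE0 : 0 < E := Real.exp_pos _
  set G := (iterConv (fun x ↦ gaussianPDF 0 1 x * f x) (m + 1) (s * x)).toReal
  set A := (∫⁻ x, f x ^ α ∂gaussianReal 0 1).toReal ^ (min α 2 / (α * (min α 2 - 1)))
  set Ψ := psi α P X (-h) ^ ((m : ℝ) + 2 - max (conjIndex α) 2)
  have hpi : 0 < Real.sqrt (2 * Real.pi) := by positivity
  have hG : G ≤ Ψ * (Real.sqrt (2 * Real.pi))⁻¹ * A * E⁻¹ := by
    rw [← div_eq_mul_inv, le_div_iff₀ hE0]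
    refine le_of_mul_le_mul_left ?_ hE0
    linarith
  calc s * G ≤ s * (Ψ * (Real.sqrt (2 * Real.pi))⁻¹ * A * E⁻¹) := by gcongr
    _ = _ := by rw [div_eq_mul_inv]; ring

/-! ### Decay of `ψ` and the tail bound (b). -/

/-- Split at `|x| = k`. The inner part contributes at most `e^{|h|k - βh²/2}`, which vanishes as
`|h| → ∞`; the outer part is bounded, uniformly in `h`, by the `L^α(Q)` norm of the tail of `f`,
small for large `k`. -/
theorem exists_psi_le_of_le_abs [IsProbabilityMeasure P] (hX : AEMeasurable X P) (hα : 1 < α)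
    (hf : Measurable f)
    (hlaw : P.map X = volume.withDensity fun x ↦ gaussianPDF 0 1 x * f x)
    (hI : ∫⁻ x, f x ^ α ∂gaussianReal 0 1 < ∞) {ε : ℝ} (hε : 0 < ε) :
    ∃ h₀ : ℝ, 0 < h₀ ∧ ∀ u, h₀ ≤ |u| → psi α P X u ≤ ε := by
  have hφ := measurable_gaussianPDF 0 1
  have hα0 : 0 < α := by linarith
  have hβ : 1 < conjIndex α := by
    unfold conjIndex; rw [lt_div_iff₀ (by linarith)]; linarith
  have hmS : ∀ k : ℕ, MeasurableSet {x : ℝ | (k : ℝ) < |x|} := fun k ↦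
    measurableSet_lt measurable_const (by fun_prop)
  set F : ℕ → ℝ → ℝ≥0∞ := fun k ↦ {x : ℝ | (k : ℝ) < |x|}.indicator f with hF
  have hFm : ∀ k, Measurable (F k) := fun k ↦ hf.indicator (hmS k)
  have htail : Tendsto (fun k ↦ (∫⁻ x, F k x ^ α ∂gaussianReal 0 1) ^ (1 / α)) atTop (nhds 0) := by
    have h1 : Tendsto (fun k ↦ ∫⁻ x, F k x ^ α ∂gaussianReal 0 1) atTop
        (nhds (∫⁻ _, 0 ∂gaussianReal 0 1)) := by
      refine tendsto_lintegral_of_dominated_convergence (fun x ↦ f x ^ α)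
        (fun k ↦ (hFm k).pow_const α) (fun k ↦ ae_of_all _ fun x ↦ ?_) hI.ne
        (ae_of_all _ fun x ↦ ?_)
      · exact ENNReal.rpow_le_rpow (Set.indicator_le_self _ _ x) hα0.le
      · refine tendsto_const_nhds.congr' ?_
        filter_upwards [eventually_ge_atTop ⌈|x|⌉₊] with k hk
        have : ¬ (k : ℝ) < |x| := not_lt.2 (Nat.ceil_le.1 hk)
        simp [hF, this, hα0]
    rw [lintegral_zero] at h1
    have h2 := h1.ennrpow_const (1 / α)
    rwa [ENNReal.zero_rpow_of_pos (by positivity)] at h2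
  obtain ⟨k, hk⟩ := (htail.eventually_lt_const
    (ENNReal.ofReal_pos.2 (half_pos hε))).exists
  have hbound : ∀ h : ℝ, psi α P X (-h)
      ≤ Real.exp (|h| * k - conjIndex α * h ^ 2 / 2) + ε / 2 := by
    intro h
    set B := conjIndex α * h ^ 2 / 2 with hB
    have hsplit : ENNReal.ofReal (psi α P X (-h) * Real.exp B)
        ≤ ENNReal.ofReal (Real.exp (|h| * k) + Real.exp B * (ε / 2)) := by
      rw [← lintegral_tilt_eq_psi hX hα hf hlaw hI, ENNReal.ofReal_add (by positivity)
        (by positivity)]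
      calc ∫⁻ x, ENNReal.ofReal (Real.exp (h * x)) * (gaussianPDF 0 1 x * f x)
          ≤ ∫⁻ x, (ENNReal.ofReal (Real.exp (|h| * k)) * (gaussianPDF 0 1 x * f x)
              + ENNReal.ofReal (Real.exp (h * x)) * (gaussianPDF 0 1 x * F k x)) := by
            refine lintegral_mono fun x ↦ ?_
            rcases lt_or_ge (k : ℝ) |x| with hx | hx
            · simp [hF, hx]
            · refine le_add_right ?_
              refine mul_le_mul_left (ENNReal.ofReal_le_ofReal (Real.exp_le_exp.2 ?_)) _
              calc h * x ≤ |h * x| := le_abs_self _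
                _ = |h| * |x| := abs_mul _ _
                _ ≤ |h| * k := by gcongr
        _ = ENNReal.ofReal (Real.exp (|h| * k)) * (∫⁻ x, gaussianPDF 0 1 x * f x)
              + ∫⁻ x, ENNReal.ofReal (Real.exp (h * x)) * (gaussianPDF 0 1 x * F k x) := by
            rw [lintegral_add_left (by fun_prop), lintegral_const_mul _ (by fun_prop)]
        _ ≤ ENNReal.ofReal (Real.exp (|h| * k)) + ENNReal.ofReal (Real.exp B * (ε / 2)) := by
            have hone : ∫⁻ x, gaussianPDF 0 1 x * f x = 1 := by
              have := Measure.isProbabilityMeasure_map hX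
              rw [← setLIntegral_univ, ← withDensity_apply _ MeasurableSet.univ, ← hlaw,
                measure_univ]
            rw [hone, mul_one]
            gcongr
            -- The case `a = 1` for the truncated function: the factor `e^{βh²/2}` is the one that
            -- `ψ` divides out.
            have ht := lintegral_tilt_rpow_le hα le_rfl hα.le (hFm k) h
            simp only [ENNReal.rpow_one, sub_self, Real.rpow_zero, one_mul] at ht
            refine ht.trans ?_
            rw [ENNReal.ofReal_mul (Real.exp_pos _).le]
            gcongr
    rw [ENNReal.ofReal_le_ofReal_iff (by positivity)] at hsplit
    have := (le_div_iff₀ (Real.exp_pos B)).2 hsplit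
    rwa [add_div, mul_div_cancel_left₀ _ (Real.exp_pos B).ne', ← Real.exp_sub] at this
  obtain ⟨L, hL⟩ := (Real.tendsto_exp_neg_atTop_nhds_zero.eventually_le_const
    (half_pos hε)).exists
  -- Since `β > 1`, `|u| ≥ 2(k + |L|)` gives `|u|k - βu²/2 ≤ -|u||L|`, and `|u| ≥ 1` makes this at
  -- most `-L`.
  refine ⟨max 1 (2 * (k + |L|)), by positivity, fun u hu ↦ ?_⟩
  have hu1 : 1 ≤ |u| := (le_max_left _ _).trans hu
  have hu2 : 2 * (k + |L|) ≤ |u| := (le_max_right _ _).trans hu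
  have hexp : |(-u)| * k - conjIndex α * (-u) ^ 2 / 2 ≤ -L := by
    have hsq : (-u) ^ 2 = |u| * |u| := by rw [neg_sq, ← sq_abs, sq]
    rw [abs_neg, hsq]
    have h1 : |u| * (2 * (k + |L|)) ≤ |u| * |u| := by gcongr
    have h2 : |u| * |u| ≤ conjIndex α * (|u| * |u|) := by
      nlinarith [mul_self_nonneg |u|]
    have h3 : |L| ≤ |u| * |L| := by nlinarith [abs_nonneg L]
    linarith [le_abs_self L]
  have := hbound (-u)
  rw [neg_neg] at this
  linarith [Real.exp_le_exp.2 hexp]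

end

/-- A polynomial factor is absorbed by an exponential gain in `ψ ^ (n / 2)`. -/
theorem eventually_mul_sqrt_mul_rpow_le (C b : ℝ) (hC : 0 ≤ C) :
    ∀ᶠ n : ℕ in atTop, ∀ y : ℝ, 0 < y → y ≤ 1 / 4 →
      C * Real.sqrt n * y ^ ((n : ℝ) - b) ≤ (3 / 4) ^ n * y ^ ((n : ℝ) / 2) := by
  have h0 : Tendsto (fun n : ℕ ↦ C * (1 / 4 : ℝ) ^ (-b) * (n * (2 / 3 : ℝ) ^ n)) atTop
      (nhds (C * (1 / 4 : ℝ) ^ (-b) * 0)) :=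
    (tendsto_self_mul_const_pow_of_lt_one (by norm_num) (by norm_num)).const_mul _
  rw [mul_zero] at h0
  -- `n ≥ 2b` keeps the exponent `n/2 - b` nonnegative, so `y ≤ 1/4` can be inserted. Then
  -- `(1/4)^{n/2} = (3/4)^n (2/3)^n`, and `(2/3)^n` absorbs the constant and the bound `√n ≤ n`.
  filter_upwards [h0.eventually_le_const one_pos, eventually_ge_atTop 1,
    tendsto_natCast_atTop_atTop.eventually_ge_atTop (2 * b)] with n hn hn1 hnb y hy hy4
  have hsqrt : Real.sqrt n ≤ n := by
    have : (1 : ℝ) ≤ n := by exact_mod_cast hn1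
    rw [Real.sqrt_le_left (by positivity)]
    nlinarith
  have hsplit : y ^ ((n : ℝ) - b) = y ^ ((n : ℝ) / 2) * y ^ ((n : ℝ) / 2 - b) := by
    rw [← Real.rpow_add hy]; congr 1; ring
  have hquarter : (1 / 4 : ℝ) ^ ((n : ℝ) / 2 - b) = (1 / 4 : ℝ) ^ (-b) * (1 / 2) ^ n := by
    rw [sub_eq_neg_add, Real.rpow_add (by norm_num)]
    congr 1
    have : (1 / 4 : ℝ) = (1 / 2) ^ (2 : ℝ) := by norm_num
    rw [this, ← Real.rpow_mul (by norm_num), mul_div_cancel₀ _ two_ne_zero, Real.rpow_natCast]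
  have hpow : (1 / 2 : ℝ) ^ n = (3 / 4) ^ n * (2 / 3) ^ n := by
    rw [← mul_pow]; norm_num
  calc C * Real.sqrt n * y ^ ((n : ℝ) - b)
      ≤ C * n * (y ^ ((n : ℝ) / 2) * (1 / 4) ^ ((n : ℝ) / 2 - b)) := by
        rw [hsplit]
        gcongr
        linarith
    _ = (C * (1 / 4 : ℝ) ^ (-b) * (n * (2 / 3 : ℝ) ^ n)) * ((3 / 4) ^ n * y ^ ((n : ℝ) / 2)) := by
        rw [hquarter, hpow]; ring
    _ ≤ 1 * ((3 / 4) ^ n * y ^ ((n : ℝ) / 2)) := by gcongr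
    _ = _ := one_mul _

theorem proposition13p1 {Ω : Type u} [MeasurableSpace Ω] (P : Measure Ω)
    [IsProbabilityMeasure P] (X : Ω → ℝ) (hX : AEMeasurable X P) (α : ℝ) (hα : 1 < α)
    (hT : tsallis α (P.map X) (gaussianReal 0 1) < ⊤) :
    (∀ u : ℝ, Integrable (fun ω => Real.exp (-(u * X ω))) P) ∧
    (∀ n : ℕ, max (conjIndex α) 2 ≤ (n : ℝ) →
      ∀ (Ω' : Type v) [MeasurableSpace Ω'] (P' : Measure Ω') [IsProbabilityMeasure P']
        (ξ : Fin n → Ω' → ℝ), IsIndepCopies ξ P' X P →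
        ∃ p : ℝ → ℝ, IsContinuousDensity p (P'.map (normalizedSum ξ)) ∧
          ∀ x : ℝ, p x ≤
            constA α (tsallis α (P.map X) (gaussianReal 0 1)).toReal * Real.sqrt n
                / Real.sqrt (2 * Real.pi)
              * Real.exp (-(x ^ 2 / (2 * conjIndex α)))
              * psi α P X (-(x / (conjIndex α * Real.sqrt n)))
                  ^ ((n : ℝ) - max (conjIndex α) 2)) ∧
    (∃ x₀ : ℝ, 0 < x₀ ∧ ∃ δ : ℝ, 0 < δ ∧ δ < 1 ∧ ∀ᶠ n : ℕ in atTop,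
      ∀ (Ω' : Type v) [MeasurableSpace Ω'] (P' : Measure Ω') [IsProbabilityMeasure P']
        (ξ : Fin n → Ω' → ℝ), IsIndepCopies ξ P' X P →
        ∃ p : ℝ → ℝ, IsContinuousDensity p (P'.map (normalizedSum ξ)) ∧
          ∀ x : ℝ, x₀ * Real.sqrt n ≤ |x| →
            p x ≤ δ ^ n * Real.exp (-(x ^ 2 / (2 * conjIndex α)))
              * psi α P X (-(x / (conjIndex α * Real.sqrt n))) ^ ((n : ℝ) / 2)) := by

  set f := (P.map X).rnDeriv (gaussianReal 0 1) with hfdef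
  have hf : Measurable f := Measure.measurable_rnDeriv _ _
  have := Measure.isProbabilityMeasure_map hX
  obtain ⟨hac, hI⟩ := (tsallis_lt_top_iff hα).1 hT
  have hlaw := eq_withDensity_gaussianPDF_mul hac
  have hβ : 0 < conjIndex α := div_pos (by linarith) (by linarith)
  have hA := constA_eq_rpow_min hα (tsallis α (P.map X) (gaussianReal 0 1)).toReal
  rw [one_add_mul_toReal_tsallis hα hT] at hA
  refine ⟨fun u ↦ ?_, fun n hn Ω' _ P' _ ξ hξ ↦ ?_, ?_⟩
  · simpa only [neg_mul] using integrable_exp_of_lintegral_rpow_lt_top hX hα hf hlaw hI (-u)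
  · rw [hA]
    exact exists_density_le hX hα hf hlaw hI hn hξ
  obtain ⟨h₀, hh₀, hψ⟩ := exists_psi_le_of_le_abs hX hα hf hlaw hI
    (ε := 1 / 4) (by norm_num)
  -- `ψ` is evaluated at `-x/(β√n)`, so `x₀ = βh₀` makes `|x| ≥ x₀√n` the condition `|u| ≥ h₀`.
  refine ⟨conjIndex α * h₀, by positivity, 3 / 4, by norm_num, by norm_num, ?_⟩
  filter_upwards [eventually_mul_sqrt_mul_rpow_le
      ((∫⁻ x, f x ^ α ∂gaussianReal 0 1).toReal ^ (min α 2 / (α * (min α 2 - 1)))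
        / Real.sqrt (2 * Real.pi)) (max (conjIndex α) 2) (by positivity),
    tendsto_natCast_atTop_atTop.eventually_ge_atTop (max (conjIndex α) 2),
    eventually_gt_atTop 0] with n hn hnβ hn0 Ω' _ P' _ ξ hξ
  obtain ⟨p, hp, hpx⟩ := exists_density_le hX hα hf hlaw hI hnβ hξ
  refine ⟨p, hp, fun x hx ↦ (hpx x).trans ?_⟩
  have hs : 0 < Real.sqrt n := Real.sqrt_pos.2 (by exact_mod_cast hn0)
  have hu : h₀ ≤ |(-(x / (conjIndex α * Real.sqrt n)))| := by
    rw [abs_neg, abs_div, abs_of_pos (mul_pos hβ hs), le_div_iff₀ (mul_pos hβ hs)]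
    linarith
  have hmain := mul_le_mul_of_nonneg_right
    (hn _ (psi_pos hX hα hf hlaw hI _) (hψ _ hu)) (Real.exp_pos (-(x ^ 2 / (2 * conjIndex α)))).le
  refine (le_of_eq ?_).trans (hmain.trans (le_of_eq ?_)) <;> ring
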